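/- There are a constant $C$ and a function $d:\{1,2,3,\dots\}\to\{0,1,2,\dots\}$ with $d(k)\le 2^{C k\log k}$ for all $k\ge 2$ such that, for every integer $k\ge 1$, every $k$-queue graph is $(2k+1,d(k))$-choosable. In short: every $k$-queue graph is $(2k+1,2^{O(k\log k)})$-choosable. Here graphs are finite and simple. A graph $G$ is a $k$-queue graph if there are a linear ordering $v_1,\dots,v_n$ of $V(G)$ and a partition of $E(G)$ into $k$ (possibly empty) sets $E_1,\dots,E_k$ such that no $E_i$ contains two edges $v_av_b$ and $v_cv_d$ with $a<c<d<b$. A graph $G$ is $(m,d)$-choosable if, for every function $L$ assigning a set $L(v)$ of exactly $m$ colours to each vertex $v$, one can choose for each vertex $v$ a colour in $L(v)$ such that every vertex has at most $d$ neighbours with the same colour as itself. -/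

import Mathlib

/-!
A graph in which every subgraph has at most `m` times as many edges as vertices is
`(m + 1, m ^ 2)`-choosable. Take a minimal counterexample `H`. A vertex of degree at most `m` can be
coloured last. If an edge `e` has two ends of degree at most `m + m ^ 2`, colour `H - e`: an end of
`e` with more than `m ^ 2` neighbours of its own colour sees fewer than `m` other colours, so it can
be given a fresh one. Otherwise the vertices of degree at most `m + m ^ 2` are independent and have
degree at least `m + 1`; the edges at them show that they are at most `m` times as numerous as the
others, and then the sum of the degrees exceeds `2 * m * |V(H)|`.

For a `k`-queue graph `m = 2 * k` works: the edges of one queue, written as pairs of positions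
`(a, b)` with `a < b`, are pairwise not nested, so they form a chain in the product order.
-/

universe u w

/-- The colouring `c` has defect `d`: every vertex has at most `d` neighbours of its own colour. -/
def HasDefect {V : Type*} {α : Type*} (G : SimpleGraph V) (c : V → α) (d : ℕ) : Prop :=
  ∀ v : V, {w : V | G.Adj v w ∧ c w = c v}.encard ≤ d

/-- `G` is `(m, d)`-choosable: for every assignment `L` of a set of exactly `m` colours to each
vertex there is a colouring with defect `d` that gives each vertex `v` a colour in `L v`. -/
def IsDefectiveChoosable {V : Type u} (G : SimpleGraph V) (m d : ℕ) : Prop :=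
  ∀ (α : Type w) (L : V → Finset α), (∀ v, (L v).card = m) →
    ∃ c : V → α, (∀ v, c v ∈ L v) ∧ HasDefect G c d

/-- A linear ordering `σ 0, …, σ (n - 1)` of the vertices and a partition of the edges into `k`
(possibly empty) parts, the fibres of `q`, form a queue layout of `G`: edges `σ a σ b` and
`σ c σ d` that are nested, in the sense that `a < c < d < b`, lie in different parts. -/
def IsQueueLayout {V : Type*} (G : SimpleGraph V) {n k : ℕ}
    (σ : Fin n ≃ V) (q : G.edgeSet → Fin k) : Prop :=
  ∀ (a b c d : Fin n) (hab : G.Adj (σ a) (σ b)) (hcd : G.Adj (σ c) (σ d)),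
    a < c → c < d → d < b →
      q ⟨s(σ a, σ b), G.mem_edgeSet.2 hab⟩ ≠ q ⟨s(σ c, σ d), G.mem_edgeSet.2 hcd⟩

/-- `G` is a `k`-queue graph: it has a `k`-queue layout. (Such a graph is finite.) -/
def IsQueueGraph {V : Type*} (G : SimpleGraph V) (k : ℕ) : Prop :=
  ∃ (n : ℕ) (σ : Fin n ≃ V) (q : G.edgeSet → Fin k), IsQueueLayout G σ q

open Finset

theorem encard_image_add_encard_fiber_le {α β : Type*} (f : α → β) (s : Set α) (b : β) :
    (f '' s).encard + {x ∈ s | f x = b}.encard ≤ s.encard + 1 := by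
  set t : Set α := {x ∈ s | f x = b}
  have himage : f '' s ⊆ insert b (f '' (s \ t)) := by
    rintro _ ⟨x, hx, rfl⟩
    by_cases hxb : f x = b
    · exact .inl hxb
    · exact .inr ⟨x, ⟨hx, fun hxt => hxb hxt.2⟩, rfl⟩
  have himage_card : (f '' s).encard ≤ (s \ t).encard + 1 :=
    calc (f '' s).encard ≤ (f '' (s \ t)).encard + 1 :=
          (Set.encard_le_encard himage).trans (Set.encard_insert_le _ _)
      _ ≤ (s \ t).encard + 1 := by gcongr; exact Set.encard_image_le f _
  calc (f '' s).encard + t.encard ≤ (s \ t).encard + 1 + t.encard := by gcongr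
    _ = s.encard + 1 := by
      rw [add_right_comm, Set.encard_sdiff_add_encard_of_subset (Set.sep_subset _ _)]

theorem card_le_card_add_card_of_isChain {α β : Type*} [PartialOrder α] [PartialOrder β]
    {s : Finset α} {t : Finset β} {C : Finset (α × β)} (hC : IsChain (· ≤ ·) (C : Set (α × β)))
    (hCst : C ⊆ s ×ˢ t) : #C ≤ #s + #t := by
  classical
  let rank (p : α × β) : ℕ := #{x ∈ s | x < p.1} + #{y ∈ t | y < p.2}
  have hrank_lt {p : α × β} (hp : p ∈ C) : rank p < #s + #t :=
    add_lt_add_of_lt_of_lt (card_lt_card <| filter_ssubset.2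
      ⟨p.1, (mem_product.1 (hCst hp)).1, lt_irrefl _⟩) (card_lt_card <| filter_ssubset.2
      ⟨p.2, (mem_product.1 (hCst hp)).2, lt_irrefl _⟩)
  have hrank_strict {p p' : α × β} (hp : p ∈ C) (h : p < p') : rank p < rank p' := by
    obtain ⟨hps, hpt⟩ := mem_product.1 (hCst hp)
    have hmono₁ : {x ∈ s | x < p.1} ⊆ {x ∈ s | x < p'.1} :=
      monotone_filter_right s fun _ _ hx => hx.trans_le h.le.1
    have hmono₂ : {y ∈ t | y < p.2} ⊆ {y ∈ t | y < p'.2} :=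
      monotone_filter_right t fun _ _ hy => hy.trans_le h.le.2
    rcases Prod.lt_iff.1 h with ⟨hlt, -⟩ | ⟨-, hlt⟩
    · refine add_lt_add_of_lt_of_le (card_lt_card ?_) (card_le_card hmono₂)
      exact (ssubset_iff_of_subset hmono₁).2 ⟨p.1, by simp [hps, hlt], by simp⟩
    · refine add_lt_add_of_le_of_lt (card_le_card hmono₁) (card_lt_card ?_)
      exact (ssubset_iff_of_subset hmono₂).2 ⟨p.2, by simp [hpt, hlt], by simp⟩
  have hinj : Set.InjOn rank C := by
    intro p hp p' hp' hpp'
    by_contra hne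
    rcases hC hp hp' hne with hle | hle
    · exact (hrank_strict hp (hle.lt_of_ne hne)).ne hpp'
    · exact (hrank_strict hp' (hle.lt_of_ne' hne)).ne' hpp'
  simpa using card_le_card_of_injOn (t := range (#s + #t)) rank
    (fun p hp => mem_coe.2 (mem_range.2 (hrank_lt hp))) hinj

section Recolouring

variable {V : Type*} {α : Type*} {G H : SimpleGraph V} {L : V → Finset α} {c : V → α} {d : ℕ}

theorem HasDefect.mono (hHG : H ≤ G) (hc : HasDefect G c d) : HasDefect H c d :=
  fun v => (Set.encard_le_encard fun _ hw => And.imp_left (@hHG v _) hw).trans (hc v)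

theorem hasDefect_bot : HasDefect (⊥ : SimpleGraph V) c d := fun v => by simp

theorem HasDefect.update [DecidableEq V] {v : V} {a : α}
    (hc : HasDefect (G.deleteIncidenceSet v) c d) (ha : ∀ w, G.Adj v w → c w ≠ a) :
    HasDefect G (Function.update c v a) d := by
  intro w
  by_cases hwv : w = v
  · subst hwv
    have hempty : {u | G.Adj w u ∧ Function.update c w a u = Function.update c w a w} = ∅ := by
      refine Set.eq_empty_of_forall_notMem fun u hu => ha u hu.1 ?_
      simpa [hu.1.ne'] using hu.2
    rw [hempty, Set.encard_empty]
    exact zero_le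
  · refine (Set.encard_le_encard ?_).trans (hc w)
    rintro u ⟨hwu, hcu⟩
    rw [Function.update_of_ne hwv] at hcu
    have huv : u ≠ v := by
      rintro rfl
      exact ha w hwu.symm (by simpa using hcu.symm)
    rw [Function.update_of_ne huv] at hcu
    exact ⟨SimpleGraph.deleteIncidenceSet_adj.2 ⟨hwu, hwv, huv⟩, hcu⟩

/-- `G` has a colouring with defect `d` that takes the colour of each vertex `v` from the list
`L v`; the lists may have different sizes. -/
def HasDefectiveListColouring (G : SimpleGraph V) (L : V → Finset α) (d : ℕ) : Prop :=
  ∃ c : V → α, (∀ v, c v ∈ L v) ∧ HasDefect G c d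

theorem HasDefect.hasDefectiveListColouring_of_recolour {v : V}
    (hc : HasDefect (G.deleteIncidenceSet v) c d) (hcL : ∀ u, c u ∈ L u)
    (hv : (c '' G.neighborSet v).encard < #(L v)) : HasDefectiveListColouring G L d := by
  classical
  obtain ⟨a, haL, ha⟩ : ∃ a ∈ (L v : Set α), a ∉ c '' G.neighborSet v := by
    by_contra! hsub
    exact hv.not_ge ((Set.encard_coe_eq_coe_finsetCard _).symm.le.trans (Set.encard_le_encard hsub))
  exact ⟨Function.update c v a, (Function.forall_update_iff c fun u b => b ∈ L u).2
    ⟨haL, fun u _ => hcL u⟩, hc.update fun w hvw hcw => ha ⟨w, hvw, hcw⟩⟩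

theorem encard_neighborSet (v : V) [Fintype (G.neighborSet v)] :
    (G.neighborSet v).encard = G.degree v :=
  Set.encard_eq_coe_toFinset_card _

theorem HasDefectiveListColouring.of_deleteIncidenceSet {v : V} [Fintype (G.neighborSet v)]
    (h : HasDefectiveListColouring (G.deleteIncidenceSet v) L d) (hv : G.degree v < #(L v)) :
    HasDefectiveListColouring G L d := by
  obtain ⟨c, hcL, hc⟩ := h
  refine hc.hasDefectiveListColouring_of_recolour hcL ((Set.encard_image_le _ _).trans_lt ?_)
  rw [encard_neighborSet]
  exact_mod_cast hv

theorem HasDefectiveListColouring.of_deleteEdges_singleton [G.LocallyFinite] {e : Sym2 V}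
    (h : HasDefectiveListColouring (G.deleteEdges {e}) L d)
    (he : ∀ v ∈ e, G.degree v < #(L v) + d) : HasDefectiveListColouring G L d := by
  obtain ⟨c, hcL, hc⟩ := h
  by_cases hcG : HasDefect G c d
  · exact ⟨c, hcL, hcG⟩
  obtain ⟨v, hv⟩ := not_forall.1 hcG
  have hve : v ∈ e := by
    by_contra hve
    refine hv ((Set.encard_le_encard ?_).trans (hc v))
    rintro w ⟨hvw, hcw⟩
    refine ⟨SimpleGraph.deleteEdges_adj.2 ⟨hvw, ?_⟩, hcw⟩
    rintro rfl
    exact hve (Sym2.mem_mk_left v w)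
  have hle : G.deleteIncidenceSet v ≤ G.deleteEdges {e} := by
    intro x y hxy
    rw [SimpleGraph.deleteIncidenceSet_adj] at hxy
    rw [SimpleGraph.deleteEdges_adj]
    refine ⟨hxy.1, ?_⟩
    rintro rfl
    rcases Sym2.mem_iff.1 hve with rfl | rfl <;> simp at hxy
  refine (hc.mono hle).hasDefectiveListColouring_of_recolour hcL ?_
  have hcolours := encard_image_add_encard_fiber_le c (G.neighborSet v) (c v)
  rw [encard_neighborSet] at hcolours
  have hsame : (d : ℕ∞) + 1 ≤ {w ∈ G.neighborSet v | c w = c v}.encard :=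
    Order.add_one_le_of_lt (not_le.1 hv)
  have hdeg : (G.degree v : ℕ∞) + 1 ≤ #(L v) + d := by exact_mod_cast he v hve
  have hcolours_le : (c '' G.neighborSet v).encard + 1 + d ≤ #(L v) + d :=
    calc _ = (c '' G.neighborSet v).encard + (d + 1) := by ring
      _ ≤ (c '' G.neighborSet v).encard + {w ∈ G.neighborSet v | c w = c v}.encard := by gcongr
      _ ≤ #(L v) + d := hcolours.trans hdeg
  rw [ENat.add_le_add_iff_right (ENat.natCast_ne_top d)] at hcolours_le
  have hfinite : (c '' G.neighborSet v).encard ≠ ⊤ :=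
    ne_top_of_le_ne_top (ENat.natCast_ne_top _) (le_self_add.trans hcolours_le)
  exact (ENat.add_one_le_iff hfinite).1 hcolours_le

theorem hasDefectiveListColouring_of_forall_subgraph [Finite V] (hL : ∀ v, (L v).Nonempty)
    (h : ∀ H ≤ G, H ≠ ⊥ → ∀ [H.LocallyFinite], (∃ v ∈ H.support, H.degree v < #(L v)) ∨
      ∃ e ∈ H.edgeSet, ∀ v ∈ e, H.degree v < #(L v) + d) :
    HasDefectiveListColouring G L d := by
  classical
  have := Fintype.ofFinite V
  suffices hsub : ∀ H ≤ G, HasDefectiveListColouring H L d from hsub G le_rfl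
  intro H
  induction H using WellFoundedLT.induction with
  | ind H ih =>
  intro hHG
  by_cases hbot : H = ⊥
  · choose c hc using hL
    exact ⟨c, hc, hbot ▸ hasDefect_bot⟩
  rcases h H hHG hbot with ⟨v, hv, hdeg⟩ | ⟨e, he, hdeg⟩
  · have hlt : H.deleteIncidenceSet v < H := by
      refine (H.deleteIncidenceSet_le v).lt_of_ne fun heq => ?_
      exact (H.support_deleteIncidenceSet_subset v (heq.symm ▸ hv)).2 rfl
    exact (ih _ hlt (hlt.le.trans hHG)).of_deleteIncidenceSet hdeg
  · have hlt : H.deleteEdges {e} < H := by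
      refine (H.deleteEdges_le _).lt_of_ne fun heq => ?_
      rw [← heq, SimpleGraph.edgeSet_deleteEdges] at he
      exact he.2 rfl
    exact (ih _ hlt (hlt.le.trans hHG)).of_deleteEdges_singleton hdeg

end Recolouring

section EdgeSparse

/-- Every subgraph of `G` has at most `m` times as many edges as vertices; for finite `G` this says
that the maximum average degree is at most `2 * m`. Subgraphs are spanning here, and their isolated
vertices are not counted. -/
def IsEdgeSparse {V : Type*} (G : SimpleGraph V) (m : ℕ) : Prop :=
  ∀ H ≤ G, H.edgeSet.encard ≤ m * H.support.encard

variable {V : Type*} {G : SimpleGraph V} {m : ℕ}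

theorem sum_degree_le_card_edgeFinset [Fintype G.edgeSet] [G.LocallyFinite] {s : Finset V}
    (hs : G.IsIndepSet (s : Set V)) : ∑ v ∈ s, G.degree v ≤ #G.edgeFinset := by
  classical
  have hdisj : (s : Set V).PairwiseDisjoint fun v => G.incidenceFinset v := by
    intro u hu v hv huv
    rw [Function.onFun, ← Finset.disjoint_coe, G.coe_incidenceFinset, G.coe_incidenceFinset,
      Set.disjoint_iff_inter_eq_empty]
    exact G.incidenceSet_inter_incidenceSet_of_not_adj (hs hu hv huv) huv
  calc ∑ v ∈ s, G.degree v = #(s.biUnion fun v => G.incidenceFinset v) := by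
        simp only [card_biUnion hdisj, G.card_incidenceFinset_eq_degree]
    _ ≤ #G.edgeFinset := card_le_card (biUnion_subset.2 fun v _ => G.incidenceFinset_subset v)

theorem isIndepSet_setOf_of_forall_edge {p : V → Prop} (hp : ∀ e ∈ G.edgeSet, ∃ v ∈ e, ¬ p v) :
    G.IsIndepSet {v | p v} := by
  intro u hu v hv _ huv
  obtain ⟨x, hx, hpx⟩ := hp s(u, v) huv
  rcases Sym2.mem_iff.1 hx with rfl | rfl
  · exact hpx hu
  · exact hpx hv

theorem exists_degree_le_or_exists_edge_degree_le [Finite V] [G.LocallyFinite]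
    (hG : G.edgeSet.encard ≤ m * G.support.encard) (hbot : G ≠ ⊥) :
    (∃ v ∈ G.support, G.degree v ≤ m) ∨ ∃ e ∈ G.edgeSet, ∀ v ∈ e, G.degree v ≤ m + m ^ 2 := by
  classical
  have := Fintype.ofFinite V
  by_contra! hcon
  obtain ⟨hlow, hlight⟩ := hcon
  let A : Finset V := {v ∈ G.support.toFinset | G.degree v ≤ m + m ^ 2}
  let B : Finset V := {v ∈ G.support.toFinset | ¬ G.degree v ≤ m + m ^ 2}
  have hAB : #A + #B = #G.support.toFinset := card_filter_add_card_filter_not _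
  have hAB_pos : 0 < #A + #B := by
    obtain ⟨x, y, hxy⟩ := SimpleGraph.ne_bot_iff_exists_adj.1 hbot
    rw [hAB, card_pos]
    exact ⟨x, Set.mem_toFinset.2 hxy.left_mem_support⟩
  have hedges : #G.edgeFinset ≤ m * (#A + #B) := by
    rw [Set.encard_eq_coe_toFinset_card, Set.encard_eq_coe_toFinset_card] at hG
    rw [hAB]
    exact_mod_cast hG
  have hsum : ∑ v ∈ A, G.degree v + ∑ v ∈ B, G.degree v = 2 * #G.edgeFinset := by
    rw [sum_filter_add_sum_filter_not]
    convert G.sum_degrees_support_eq_twice_card_edges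
  have hA_edges : ∑ v ∈ A, G.degree v ≤ #G.edgeFinset := by
    refine sum_degree_le_card_edgeFinset (Set.Pairwise.mono (fun v hv => (mem_filter.1 hv).2) ?_)
    exact isIndepSet_setOf_of_forall_edge fun e he => (hlight e he).imp fun _ h => ⟨h.1, h.2.not_ge⟩
  have hA_low : #A * (m + 1) ≤ ∑ v ∈ A, G.degree v :=
    A.card_nsmul_le_sum _ (m + 1) fun v hv => hlow v (Set.mem_toFinset.1 (mem_filter.1 hv).1)
  have hB_low : #B * (m + m ^ 2 + 1) ≤ ∑ v ∈ B, G.degree v :=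
    B.card_nsmul_le_sum _ (m + m ^ 2 + 1) fun v hv => not_le.1 (mem_filter.1 hv).2
  have hA_le : #A ≤ m * #B := by linarith
  have hcount : #A * (m + 1) + #B * (m + m ^ 2 + 1) ≤ 2 * m * (#A + #B) := by linarith
  have hB : #B = 0 := by
    rcases m with _ | t
    · linarith
    · nlinarith
  have hA : #A = 0 := by simpa [hB] using hA_le
  omega

theorem IsEdgeSparse.isDefectiveChoosable {V : Type u} [Finite V] {G : SimpleGraph V} {m : ℕ}
    (hG : IsEdgeSparse G m) : IsDefectiveChoosable.{u, w} G (m + 1) (m ^ 2) := by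
  intro α L hL
  refine hasDefectiveListColouring_of_forall_subgraph
    (fun v => card_pos.1 (by rw [hL]; exact m.succ_pos)) fun H hHG hbot _ => ?_
  simp only [hL, Nat.lt_succ_iff, Nat.add_right_comm m 1]
  exact exists_degree_le_or_exists_edge_degree_le (hG H hHG) hbot

end EdgeSparse

section QueueLayout

variable {V : Type*} {G H : SimpleGraph V} {n k : ℕ} {σ : Fin n ≃ V} {q : G.edgeSet → Fin k}

theorem IsQueueLayout.mono (hHG : H ≤ G) (hq : IsQueueLayout G σ q) :
    IsQueueLayout H σ fun e => q ⟨e, SimpleGraph.edgeSet_mono hHG e.2⟩ :=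
  fun a b c d hab hcd => hq a b c d (hHG hab) (hHG hcd)

/-- The positions `(a, b)`, `a ≤ b`, of the two ends of `e` in the ordering `σ`. -/
def endPositions (σ : Fin n ≃ V) (e : Sym2 V) : Fin n × Fin n :=
  ((e.map σ.symm).inf, (e.map σ.symm).sup)

theorem endPositions_injective (σ : Fin n ≃ V) : Function.Injective (endPositions σ) :=
  fun _ _ h => Sym2.map.injective σ.symm.injective
    (Sym2.inf_eq_inf_and_sup_eq_sup.1 (Prod.mk.inj h))

theorem exists_lt_endPositions_eq (σ : Fin n ≃ V) {e : Sym2 V} (he : e ∈ G.edgeSet) :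
    ∃ a b, a < b ∧ e = s(σ a, σ b) ∧ endPositions σ e = (a, b) := by
  induction e using Sym2.ind with
  | _ x y =>
  rcases lt_or_gt_of_ne (σ.symm.injective.ne (SimpleGraph.Adj.ne he)) with h | h
  · exact ⟨σ.symm x, σ.symm y, h, by simp, by simp [endPositions, h.le]⟩
  · exact ⟨σ.symm y, σ.symm x, h, by simp [Sym2.eq_swap], by simp [endPositions, h.le]⟩

theorem IsQueueLayout.isChain_endPositions (hq : IsQueueLayout G σ q) (i : Fin k) :
    IsChain (· ≤ ·) ((endPositions σ ∘ Subtype.val) '' (q ⁻¹' {i})) := by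
  rintro _ ⟨⟨e, he⟩, rfl, rfl⟩ _ ⟨⟨e', he'⟩, hqe, rfl⟩ -
  obtain ⟨a, b, hab, rfl, hab_eq⟩ := exists_lt_endPositions_eq σ he
  obtain ⟨a', b', hab', rfl, hab_eq'⟩ := exists_lt_endPositions_eq σ he'
  simp only [Function.comp_apply, hab_eq, hab_eq', Prod.mk_le_mk]
  have hnested : ¬ (a < a' ∧ b' < b) := fun h => hq a b a' b' he he' h.1 hab' h.2 hqe.symm
  have hnested' : ¬ (a' < a ∧ b < b') := fun h => hq a' b' a b he' he h.1 hab h.2 hqe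
  grind

theorem IsQueueLayout.card_fiber_le [Fintype G.edgeSet] [Fintype G.support]
    (hq : IsQueueLayout G σ q) (i : Fin k) :
    #{e : G.edgeSet | q e = i} ≤ 2 * #G.support.toFinset := by
  classical
  let S : Finset (Fin n) := G.support.toFinset.map σ.symm.toEmbedding
  let C : Finset (Fin n × Fin n) :=
    {e : G.edgeSet | q e = i}.toFinset.image (endPositions σ ∘ Subtype.val)
  have hC : IsChain (· ≤ ·) (C : Set (Fin n × Fin n)) := by
    rw [coe_image, Set.coe_toFinset]
    exact hq.isChain_endPositions i
  have hCS : C ⊆ S ×ˢ S := by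
    refine image_subset_iff.2 fun ⟨e, he⟩ _ => ?_
    obtain ⟨a, b, -, rfl, hab_eq⟩ := exists_lt_endPositions_eq σ he
    have hab : G.Adj (σ a) (σ b) := he
    simpa [hab_eq, S] using ⟨hab.left_mem_support, hab.right_mem_support⟩
  calc #{e : G.edgeSet | q e = i} = #C := by
        rw [card_image_of_injective _ ((endPositions_injective σ).comp Subtype.val_injective)]
        simp
    _ ≤ #S + #S := card_le_card_add_card_of_isChain hC hCS
    _ = 2 * #G.support.toFinset := by rw [card_map, two_mul]

theorem IsQueueLayout.encard_edgeSet_le (hq : IsQueueLayout G σ q) :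
    G.edgeSet.encard ≤ (2 * k : ℕ) * G.support.encard := by
  classical
  have : Fintype V := .ofEquiv _ σ
  have hcard : #G.edgeFinset ≤ 2 * k * #G.support.toFinset :=
    calc #G.edgeFinset = #(univ : Finset G.edgeSet) := Set.toFinset_card _
      _ ≤ 2 * #G.support.toFinset * #(univ : Finset (Fin k)) :=
        card_le_mul_card_image_of_maps_to (fun e _ => mem_univ (q e)) _ fun i _ =>
          hq.card_fiber_le i
      _ = 2 * k * #G.support.toFinset := by rw [card_univ, Fintype.card_fin, mul_right_comm]
  rw [Set.encard_eq_coe_toFinset_card, Set.encard_eq_coe_toFinset_card]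
  exact_mod_cast hcard

theorem IsQueueLayout.isEdgeSparse (hq : IsQueueLayout G σ q) : IsEdgeSparse G (2 * k) :=
  fun _ hHG => (hq.mono hHG).encard_edgeSet_le

end QueueLayout

theorem sq_two_mul_le_two_rpow {k : ℕ} (hk : 2 ≤ k) :
    (((2 * k) ^ 2 : ℕ) : ℝ) ≤ (2 : ℝ) ^ ((8 : ℝ) * ((k : ℝ) * Real.log (k : ℝ))) := by
  have hlog : 1 / 2 ≤ Real.log k := by
    have hlog_two : Real.log 2 ≤ Real.log k := Real.log_le_log two_pos (by exact_mod_cast hk)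
    linarith [Real.log_two_gt_d9]
  have hpow : (2 * k) ^ 2 ≤ 2 ^ (4 * k) :=
    calc (2 * k) ^ 2 ≤ (2 ^ k * 2 ^ k) ^ 2 := by
          gcongr
          · exact Nat.le_self_pow (by omega) 2
          · exact Nat.lt_two_pow_self.le
      _ = 2 ^ (4 * k) := by ring
  calc (((2 * k) ^ 2 : ℕ) : ℝ) ≤ 2 ^ (4 * k) := by exact_mod_cast hpow
    _ = (2 : ℝ) ^ ((4 : ℝ) * k) := by exact_mod_cast (Real.rpow_natCast 2 (4 * k)).symm
    _ ≤ (2 : ℝ) ^ ((8 : ℝ) * (k * Real.log k)) := by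
      refine Real.rpow_le_rpow_of_exponent_le one_le_two ?_
      nlinarith [mul_le_mul_of_nonneg_left hlog (Nat.cast_nonneg (α := ℝ) k)]

theorem mainTheorem7_general {V : Type u} {G : SimpleGraph V} {k : ℕ} (hG : IsQueueGraph G k) :
    IsDefectiveChoosable.{u, w} G (2 * k + 1) ((2 * k) ^ 2) := by
  obtain ⟨n, σ, q, hq⟩ := hG
  have : Finite V := .of_equiv _ σ
  exact hq.isEdgeSparse.isDefectiveChoosable

theorem mainTheorem7 :
    ∃ (C : ℝ) (d : ℕ → ℕ),
      (∀ k : ℕ, 2 ≤ k → (d k : ℝ) ≤ (2 : ℝ) ^ (C * ((k : ℝ) * Real.log (k : ℝ)))) ∧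
      ∀ (k : ℕ), 1 ≤ k → ∀ (V : Type u) (G : SimpleGraph V), IsQueueGraph G k →
        IsDefectiveChoosable.{u, w} G (2 * k + 1) (d k) :=
  ⟨8, fun k => (2 * k) ^ 2, fun _ hk => sq_two_mul_le_two_rpow hk,
    fun _ _ _ _ hG => mainTheorem7_general hG⟩
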